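/- Let $\mathcal R$ be a nonzero finite associative ring with $1$ (not necessarily commutative), let $J(\mathcal R)$ be its Jacobson radical, and let $\mathcal R/J(\mathcal R)\cong M_{n_1}(\mathbb F_{q_1})\times\dots\times M_{n_d}(\mathbb F_{q_d})$ be a Wedderburn–Artin decomposition, where $\mathbb F_{q_i}$ is a finite field with $q_i$ elements and $n_i\ge 1$. Let $\preceq$ be a partial order on a finite set with $n\ge 1$ elements, say $\{1,\dots,n\}$, and let $c$ be the number of pairs $(i,j)$ such that $i\prec j$ and there is no $k$ with $i\prec k\prec j$. Let $$\mathcal A=\mathcal A_n(\preceq,\mathcal R)=\{A\in M_n(\mathcal R)\mid (A)_{ij}=0\text{ whenever } i\not\preceq j\}$$ be the incidence ring, and let $\mathcal R I=\{rI\mid r\in\mathcal R\}$ be the set of scalar matrices. Let $\mathrm{mgen}(\mathcal A)$ be the least integer $m\ge 0$ for which there are $A_1,\dots,A_m\in\mathcal A$ such that $\{A_1,\dots,A_m\}\cup\mathcal R I$ generates $\mathcal A$ as a ring. Then for every integer $m\ge\mathrm{mgen}(\mathcal A)$, the probability that, for $(A_1,\dots,A_m)$ uniformly distributed on $\mathcal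 A^m$, the set $\{A_1,\dots,A_m\}\cup\mathcal R I$ generates $\mathcal A$ as a ring is equal to $$\prod_{i=1}^{d}\left[\left(1-\frac1{q_i^{\,n_i^2m-1}}\right)^{c}\ \prod_{\ell=1}^{n-1}\left(1-\frac{\ell}{q_i^{\,n_i^2m}}\right)\right],$$ where $0^0=1$. -/

import Mathlib

/-- The incidence ring of a finite poset `ι` over a ring `R`: the subring of all matrices `A`, with
rows and columns indexed by `ι`, such that `A i j = 0` for all pairs with `¬ i ≤ j`. -/
def incidenceRing (ι R : Type*) [Fintype ι] [DecidableEq ι] [PartialOrder ι] [Ring R] :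
    Subring (Matrix ι ι R) where
  carrier := {A | ∀ i j, ¬ i ≤ j → A i j = 0}
  zero_mem' := fun _ _ _ => rfl
  one_mem' := fun _ _ hij => Matrix.one_apply_ne fun h => hij h.le
  add_mem' := by
    intro A B hA hB i j hij
    rw [Matrix.add_apply, hA i j hij, hB i j hij, add_zero]
  neg_mem' := by
    intro A hA i j hij
    rw [Matrix.neg_apply, hA i j hij, neg_zero]
  mul_mem' := by
    intro A B hA hB i j hij
    rw [Matrix.mul_apply]
    refine Finset.sum_eq_zero fun k _ => ?_
    by_cases hik : i ≤ k
    · rw [hB k j fun hkj => hij (hik.trans hkj), mul_zero]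
    · rw [hA i k hik, zero_mul]

/-- The set of all scalar matrices `r • I`, `r ∈ R`, inside the incidence ring. -/
def scalarMatrices (ι R : Type*) [Fintype ι] [DecidableEq ι] [PartialOrder ι] [Ring R] :
    Set (incidenceRing ι R) :=
  {B | ∃ r : R, (B : Matrix ι ι R) = Matrix.scalar ι r}

/-- The set of all `m`-tuples of elements of the incidence ring that, together with all scalar
matrices, generate the incidence ring as a (unital) ring. -/
def Gen (ι R : Type*) [Fintype ι] [DecidableEq ι] [PartialOrder ι] [Ring R] (m : ℕ) :
    Set (Fin m → incidenceRing ι R) :=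
  {A | Subring.closure (Set.range A ∪ scalarMatrices ι R) = ⊤}

/-- The least length of a tuple that, together with all scalar matrices, generates the incidence
ring. -/
noncomputable def mgen (ι R : Type*) [Fintype ι] [DecidableEq ι] [PartialOrder ι] [Ring R] : ℕ :=
  sInf {m : ℕ | (Gen ι R m).Nonempty}

/-- The probability that a uniformly random `m`-tuple of elements of the (finite) incidence ring
generates it together with all scalar matrices. -/
noncomputable def genProbability (ι R : Type*) [Fintype ι] [DecidableEq ι] [PartialOrder ι] [Ring R]
    [Finite R] (m : ℕ) : ℝ :=
  letI : Fintype (Fin m → incidenceRing ι R) := Fintype.ofFinite _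
  ((PMF.uniformOfFintype (Fin m → incidenceRing ι R)).toOuterMeasure (Gen ι R m)).toReal

/-- The number of pairs `(i, j)` such that `j` covers `i`, that is `i < j` and there is no `k` with
`i < k < j`. -/
noncomputable def numCovers (ι : Type*) [PartialOrder ι] : ℕ :=
  Nat.card {p : ι × ι // p.1 ⋖ p.2}

/-! Modulo the Jacobson radical the coefficients become a product of matrix rings over finite
fields, and Nakayama's lemma shows that generation can be tested there. Multiplying by scalar
matrices on both sides extracts single matrix coordinates and isolates single factors, so the
question reduces to subalgebras of the incidence algebra over each field `F s`. Such a subalgebra is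
everything iff it separates the diagonal positions and, at each cover `i ⋖ j`, satisfies no relation
`X i j = x * (X i i - X j j)` (`mem_of_separates_of_covBy`, `closure_eq_top_iff`).

Counting is then linear algebra. In each factor a tuple amounts to one vector of V = F^(m·k²) for
every pair `i ≤ j`. The diagonal vectors must be distinct, which gives the product over ℓ; each
cover vector must avoid the line spanned by a nonzero difference, which gives 1 - |F|/|V|; the
remaining vectors are free. The map from tuples to vectors is a surjective group homomorphism
(`labelings_surjective`), so densities are preserved and multiply over the factors. -/

/-- A product of elements supported on `{p ≤ i, r ≤ q}` and `{p ≤ r', j ≤ q}` is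
supported on `{p ≤ i, j ≤ q}`. -/
theorem mul_apply_eq_zero_of_supported {ι F : Type*} [Fintype ι] [Preorder ι]
    [NonUnitalNonAssocSemiring F] {i r r' j : ι} {X Y : Matrix ι ι F}
    (hX : ∀ p q, ¬ (p ≤ i ∧ r ≤ q) → X p q = 0)
    (hY : ∀ p q, ¬ (p ≤ r' ∧ j ≤ q) → Y p q = 0) (p q : ι) (hpq : ¬ (p ≤ i ∧ j ≤ q)) :
    (X * Y) p q = 0 := by
  rw [Matrix.mul_apply]
  refine Finset.sum_eq_zero fun u _ => ?_
  by_cases hp : p ≤ i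
  · rw [hY u q fun h => hpq ⟨hp, h.2⟩, mul_zero]
  · rw [hX p u fun h => hp h.1, zero_mul]

/-! ### Subalgebras of incidence algebras over a field -/

section Incidence

variable {ι : Type*} [Fintype ι] [DecidableEq ι] [PartialOrder ι]

theorem incidenceRing_mul_apply_self {R : Type*} [Ring R] {X Y : Matrix ι ι R}
    (hX : X ∈ incidenceRing ι R) (hY : Y ∈ incidenceRing ι R) (i : ι) :
    (X * Y) i i = X i i * Y i i := by
  rw [Matrix.mul_apply]
  refine Finset.sum_eq_single_of_mem i (Finset.mem_univ i) fun r _ hr => ?_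
  by_cases hir : i ≤ r
  · rw [hY r i fun hri => hr (le_antisymm hri hir), mul_zero]
  · rw [hX i r hir, zero_mul]

theorem incidenceRing_mul_apply_covBy {R : Type*} [Ring R] {X Y : Matrix ι ι R}
    (hX : X ∈ incidenceRing ι R) (hY : Y ∈ incidenceRing ι R) {i j : ι} (hij : i ⋖ j) :
    (X * Y) i j = X i i * Y i j + X i j * Y j j := by
  rw [Matrix.mul_apply, ← Finset.sum_subset (Finset.subset_univ {i, j}),
    Finset.sum_pair hij.lt.ne]
  intro r _ hr
  by_cases hir : i ≤ r
  · by_cases hrj : r ≤ j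
    · exact absurd (hij.eq_or_eq hir hrj) (by simpa using hr)
    · rw [hY r j hrj, mul_zero]
  · rw [hX i r hir, zero_mul]

theorem single_mem_incidenceRing {R : Type*} [Ring R] {i j : ι} (hij : i ≤ j) (r : R) :
    Matrix.single i j r ∈ incidenceRing ι R := by
  intro p q hpq
  refine Matrix.single_apply_of_ne _ _ _ _ _ ?_
  rintro ⟨rfl, rfl⟩
  exact hpq hij

variable {F : Type*} [Field F]

/-- If the diagonal of an element of an incidence ring vanishes except at `i`, then the entries of
its powers at the pairs `(p, q)` without `p ≤ i ≤ q` vanish once the interval is short. -/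
theorem pow_apply_eq_zero_of_diagonal {D : Matrix ι ι F} (hD : D ∈ incidenceRing ι F) {i : ι}
    (hd : ∀ p, p ≠ i → D p p = 0) (k : ℕ) (p q : ι) (hpq : ¬ (p ≤ i ∧ i ≤ q))
    (hk : (Set.Icc p q).ncard ≤ k) : (D ^ k) p q = 0 := by
  induction k generalizing p with
  | zero =>
    rw [pow_zero]
    refine Matrix.one_apply_ne ?_
    rintro rfl
    simp at hk
  | succ k ih =>
    -- The term r = p vanishes by `hd`, or, when p = i, because then i ≤ q fails; a term with r > p
    -- has a shorter interval.
    rw [pow_succ', Matrix.mul_apply]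
    refine Finset.sum_eq_zero fun r _ => ?_
    by_cases hpr : p ≤ r
    · rcases hpr.eq_or_lt with rfl | hlt
      · by_cases hpi : p = i
        · subst hpi
          rw [(pow_mem hD k : D ^ k ∈ incidenceRing ι F) p q fun h => hpq ⟨le_rfl, h⟩, mul_zero]
        · rw [hd p hpi, zero_mul]
      · by_cases hrq : r ≤ q
        · rw [ih r (fun h => hpq ⟨hpr.trans h.1, h.2⟩), mul_zero]
          have : (Set.Icc r q).ncard < (Set.Icc p q).ncard := by
            refine Set.ncard_lt_ncard ?_ (Set.toFinite _)
            refine (Set.ssubset_iff_of_subset (Set.Icc_subset_Icc_left hpr)).2 ⟨p, ?_, ?_⟩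
            · exact ⟨le_rfl, hpr.trans hrq⟩
            · exact fun h => absurd h.1 hlt.not_ge
          omega
        · rw [(pow_mem hD k : D ^ k ∈ incidenceRing ι F) r q hrq, mul_zero]
    · rw [hD p r hpr, zero_mul]

/-- A subalgebra of an incidence algebra that separates the diagonal entries contains, for each
`i`, an element with entry `1` at `(i, i)` that is supported on the pairs `p ≤ i ≤ q`. -/
theorem exists_mem_supported_self {B : Subalgebra F (Matrix ι ι F)}
    (hB : ∀ X ∈ B, X ∈ incidenceRing ι F)
    (hsep : ∀ i j, i ≠ j → ∃ X ∈ B, X i i ≠ X j j) (i : ι) :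
    ∃ D ∈ B, D i i = 1 ∧ ∀ p q, ¬ (p ≤ i ∧ i ≤ q) → D p q = 0 := by
  have key : ∀ s : Finset ι, i ∉ s → ∃ D ∈ B, D i i = 1 ∧ ∀ p ∈ s, D p p = 0 := by
    intro s
    induction s using Finset.induction_on with
    | empty => exact fun _ => ⟨1, one_mem B, Matrix.one_apply_eq i, by simp⟩
    | insert j s _ ih =>
      intro his
      rw [Finset.mem_insert, not_or] at his
      obtain ⟨D, hD, hDi, hDs⟩ := ih his.2
      obtain ⟨X, hX, hne⟩ := hsep i j his.1
      -- Lagrange interpolation on the diagonal: this factor is 1 at i and 0 at j.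
      have hY : (X i i - X j j)⁻¹ • (X - X j j • (1 : Matrix ι ι F)) ∈ B :=
        B.smul_mem (B.sub_mem hX (B.smul_mem (one_mem B) _)) _
      refine ⟨_, B.mul_mem hY hD, ?_, ?_⟩
      · rw [incidenceRing_mul_apply_self (hB _ hY) (hB _ hD), hDi, mul_one]
        simp [sub_ne_zero.2 hne]
      · intro p hp
        rw [incidenceRing_mul_apply_self (hB _ hY) (hB _ hD)]
        rcases Finset.mem_insert.1 hp with rfl | hp
        · simp
        · rw [hDs p hp, mul_zero]
  obtain ⟨D, hD, hDi, hDs⟩ := key (Finset.univ.erase i) (Finset.notMem_erase i _)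
  -- No interval has more than `Fintype.card ι` elements, so this power has no entries off the
  -- required support.
  refine ⟨D ^ Fintype.card ι, pow_mem hD _, ?_, fun p q hpq => ?_⟩
  · have : ∀ k, (D ^ k) i i = 1 := by
      intro k
      induction k with
      | zero => simp
      | succ k ih =>
        rw [pow_succ, incidenceRing_mul_apply_self (hB _ (pow_mem hD k)) (hB _ hD), ih, hDi,
          mul_one]
    exact this _
  · refine pow_apply_eq_zero_of_diagonal (hB D hD)
      (fun p hp => hDs p (Finset.mem_erase.2 ⟨hp, Finset.mem_univ p⟩)) _ p q hpq ?_
    rw [← Nat.card_eq_fintype_card]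
    exact Set.ncard_le_card _

/-- A subalgebra of an incidence algebra over a field is the whole algebra if it separates the
diagonal entries and if, at each covering pair, its entries are not given by a multiple of
the difference of the diagonal entries. -/
theorem mem_of_separates_of_covBy {B : Subalgebra F (Matrix ι ι F)}
    (hB : ∀ X ∈ B, X ∈ incidenceRing ι F)
    (hsep : ∀ i j, i ≠ j → ∃ X ∈ B, X i i ≠ X j j)
    (hcov : ∀ i j, i ⋖ j → ∀ x : F, ∃ X ∈ B, X i j ≠ x * (X i i - X j j))
    {Y : Matrix ι ι F} (hY : Y ∈ incidenceRing ι F) : Y ∈ B := by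
  have hcov' : ∀ i j, i ⋖ j →
      ∃ X ∈ B, X i j ≠ 0 ∧ ∀ p q, ¬ (p ≤ i ∧ j ≤ q) → X p q = 0 := by
    intro i j hij
    obtain ⟨D, hD, hDi, hDs⟩ := exists_mem_supported_self hB hsep i
    obtain ⟨E, hE, hEj, hEs⟩ := exists_mem_supported_self hB hsep j
    have hentry : ∀ X ∈ B, (D * (X * E)) i j = X i i * E i j + X i j + D i j * X j j := by
      intro X hX
      rw [incidenceRing_mul_apply_covBy (hB _ hD) (hB _ (B.mul_mem hX hE)) hij,
        incidenceRing_mul_apply_covBy (hB _ hX) (hB _ hE) hij,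
        incidenceRing_mul_apply_self (hB _ hX) (hB _ hE), hDi, hEj, mul_one, mul_one, one_mul]
    have hsupp : ∀ X ∈ B, ∀ p q, ¬ (p ≤ i ∧ j ≤ q) → (D * (X * E)) p q = 0 := by
      intro X _ p q hpq
      rw [← mul_assoc, Matrix.mul_apply]
      refine Finset.sum_eq_zero fun u _ => ?_
      by_cases hp : p ≤ i
      · rw [hEs u q fun h => hpq ⟨hp, h.2⟩, mul_zero]
      · rw [Matrix.mul_apply, Finset.sum_eq_zero, zero_mul]
        intro v _
        rw [hDs p v fun h => hp h.1, zero_mul]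
    by_contra hcon
    have hzero : ∀ X ∈ B, X i i * E i j + X i j + D i j * X j j = 0 := by
      intro X hX
      by_contra hne
      exact hcon ⟨_, B.mul_mem hD (B.mul_mem hX hE), by rwa [hentry X hX], hsupp X hX⟩
    -- The case X = 1 gives E i j = -D i j, so `hzero` becomes the forbidden relation with x = D i
    -- j.
    obtain ⟨X, hX, hne⟩ := hcov i j hij (D i j)
    have h1 := hzero 1 (one_mem B)
    rw [Matrix.one_apply_eq, Matrix.one_apply_eq, Matrix.one_apply_ne hij.lt.ne] at h1
    exact hne (by linear_combination hzero X hX - X i i * h1)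
  have hle : ∀ j i, i ≤ j →
      ∃ X ∈ B, X i j ≠ 0 ∧ ∀ p q, ¬ (p ≤ i ∧ j ≤ q) → X p q = 0 := by
    intro j i
    induction i using WellFoundedGT.induction with
    | ind i ih =>
      intro hij
      rcases hij.eq_or_lt with rfl | hlt
      · obtain ⟨D, hD, hDi, hDs⟩ := exists_mem_supported_self hB hsep i
        exact ⟨D, hD, by rw [hDi]; exact one_ne_zero, hDs⟩
      -- Nonzero entries multiply along a chain of covers: X lives on columns ≥ r and Z on rows ≤ r,
      -- so only r contributes to the (i, j) entry.
      · obtain ⟨r, hir, hrj⟩ := exists_covBy_le_of_lt hlt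
        obtain ⟨X, hX, hX0, hXs⟩ := hcov' i r hir
        obtain ⟨Z, hZ, hZ0, hZs⟩ := ih r hir.lt hrj
        refine ⟨X * Z, B.mul_mem hX hZ, ?_, mul_apply_eq_zero_of_supported hXs hZs⟩
        rw [Matrix.mul_apply, Finset.sum_eq_single_of_mem r (Finset.mem_univ r)]
        · exact mul_ne_zero hX0 hZ0
        · intro u _ hu
          by_cases hru : r ≤ u
          · rw [hZs u j fun h => hu (le_antisymm h.1 hru), mul_zero]
          · rw [hXs i u fun h => hru h.2, zero_mul]
  -- Induction from large intervals to small ones: the other entries of X sit at strictly larger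
  -- intervals, whose matrix units are already in B.
  have hsingle : ∀ (n : ℕ) (i j : ι), i ≤ j → Fintype.card ι - (Set.Icc i j).ncard < n →
      Matrix.single i j 1 ∈ B := by
    intro n
    induction n with
    | zero => intro i j _ h; omega
    | succ n ih =>
      intro i j hij hn
      obtain ⟨X, hX, hX0, hXs⟩ := hle j i hij
      have hmem : X - X i j • Matrix.single i j (1 : F) ∈ B := by
        rw [Matrix.matrix_eq_sum_single (X - X i j • Matrix.single i j (1 : F))]
        refine B.sum_mem fun p _ => B.sum_mem fun q _ => ?_
        by_cases hpq : p ≤ i ∧ j ≤ q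
        · by_cases heq : p = i ∧ q = j
          · obtain ⟨rfl, rfl⟩ := heq
            simp [B.zero_mem]
          · have (c : F) : Matrix.single p q c = c • Matrix.single p q (1 : F) := by
              rw [Matrix.smul_single, smul_eq_mul, mul_one]
            rw [this]
            refine B.smul_mem (ih p q (hpq.1.trans (hij.trans hpq.2)) ?_) _
            have hlt : (Set.Icc i j).ncard < (Set.Icc p q).ncard := by
              refine Set.ncard_lt_ncard (lt_of_le_of_ne (Set.Icc_subset_Icc hpq.1 hpq.2) ?_)
                (Set.toFinite _)
              intro h
              have hp : p ∈ Set.Icc i j := h ▸ ⟨le_rfl, hpq.1.trans (hij.trans hpq.2)⟩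
              have hq : q ∈ Set.Icc i j := h ▸ ⟨hpq.1.trans (hij.trans hpq.2), le_rfl⟩
              exact heq ⟨le_antisymm hpq.1 hp.1, le_antisymm hq.2 hpq.2⟩
            have hcard : (Set.Icc p q).ncard ≤ Fintype.card ι := by
              rw [← Nat.card_eq_fintype_card]
              exact Set.ncard_le_card _
            omega
        · have hne : ¬ (i = p ∧ j = q) := by
            rintro ⟨rfl, rfl⟩
            exact hpq ⟨le_rfl, le_rfl⟩
          rw [Matrix.sub_apply, Matrix.smul_apply, hXs p q hpq,
            Matrix.single_apply_of_ne _ _ _ _ _ hne]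
          simp [B.zero_mem]
      have h2 : X i j • Matrix.single i j (1 : F) ∈ B := by
        simpa using B.sub_mem hX hmem
      have h3 := B.smul_mem h2 (X i j)⁻¹
      rwa [smul_smul, inv_mul_cancel₀ hX0, one_smul] at h3
  rw [Matrix.matrix_eq_sum_single Y]
  refine B.sum_mem fun p _ => B.sum_mem fun q _ => ?_
  by_cases hpq : p ≤ q
  · have := B.smul_mem (hsingle _ p q hpq (Nat.lt_succ_self _)) (Y p q)
    rwa [Matrix.smul_single, smul_eq_mul, mul_one] at this
  · rw [hY p q hpq, Matrix.single_zero]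
    exact B.zero_mem

end Incidence

/-! ### Reduction to the simple factors and the generation criterion -/

section Criterion

/-- A submodule of a finite module that together with the multiples by the Jacobson radical
spans the module is the whole module. -/
theorem Submodule.eq_top_of_sup_jacobson_smul_eq_top {R M : Type*} [Ring R] [AddCommGroup M]
    [Module R M] [IsCoatomic (Submodule R M)] {N : Submodule R M}
    (h : N ⊔ Ring.jacobson R • (⊤ : Submodule R M) = ⊤) : N = ⊤ := by
  -- Nakayama: every maximal submodule contains the multiples by the radical.
  rcases eq_top_or_exists_le_coatom N with hN | ⟨m, hm, hNm⟩
  · exact hN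
  · refine absurd (top_le_iff.1 (h ▸ sup_le hNm ?_)) hm.1
    exact (Ring.jacobson_smul_top_le R M).trans (sInf_le hm)

theorem scalar_mul_apply {ι R : Type*} [Fintype ι] [DecidableEq ι] [Ring R]
    (r : R) (X : Matrix ι ι R) (i j : ι) :
    (Matrix.scalar ι r * X) i j = r * X i j := Matrix.diagonal_mul _ _ _ _

theorem mul_scalar_apply {ι R : Type*} [Fintype ι] [DecidableEq ι] [Ring R]
    (r : R) (X : Matrix ι ι R) (i j : ι) :
    (X * Matrix.scalar ι r) i j = X i j * r := Matrix.mul_diagonal _ _ _ _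

variable {ι : Type*} [Fintype ι] [DecidableEq ι] [PartialOrder ι]

/-- The incidence ring as a left module over the ring of coefficients. -/
def incidenceModule (ι R : Type*) [Fintype ι] [DecidableEq ι] [PartialOrder ι] [Ring R] :
    Submodule R (Matrix ι ι R) where
  __ := (incidenceRing ι R).toAddSubgroup
  smul_mem' := by
    intro r A hA i j hij
    rw [Matrix.smul_apply, hA i j hij, smul_zero]

/-- The matrix unit at a pair `i ≤ j`, as an element of the incidence module. -/
def singleIncidenceModule {R : Type*} [Ring R] {i j : ι} (hij : i ≤ j) : incidenceModule ι R :=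
  ⟨Matrix.single i j 1, single_mem_incidenceRing hij 1⟩

theorem scalar_mem_incidenceRing {R : Type*} [Ring R] (r : R) :
    Matrix.scalar ι r ∈ incidenceRing ι R :=
  fun _ _ hij => Matrix.diagonal_apply_ne _ fun h => hij h.le

/-- A subring of the incidence ring that contains all scalar matrices, and contains each matrix
unit up to the Jacobson radical of the coefficients, is the whole incidence ring. -/
theorem eq_top_of_exists_sub_mem_jacobson {R : Type*} [Ring R] [Finite R]
    {S : Subring (incidenceRing ι R)} (hS : scalarMatrices ι R ⊆ S)
    (h : ∀ i j, i ≤ j → ∃ Y ∈ S, ∀ p q,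
      Matrix.single i j (1 : R) p q - (Y : Matrix ι ι R) p q ∈ Ring.jacobson R) : S = ⊤ := by
  -- Containing the scalar matrices makes S a left R-submodule, to which Nakayama applies.
  let N : Submodule R (incidenceModule ι R) :=
    { carrier := {X | ∃ Y ∈ S, Y.1 = X.1}
      zero_mem' := ⟨0, S.zero_mem, rfl⟩
      add_mem' := by
        rintro X X' ⟨Y, hY, h⟩ ⟨Y', hY', h'⟩
        exact ⟨Y + Y', S.add_mem hY hY', congrArg₂ (· + ·) h h'⟩
      smul_mem' := by
        rintro r X ⟨Y, hY, h⟩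
        have h1 : (⟨Matrix.scalar ι r, scalar_mem_incidenceRing r⟩ : incidenceRing ι R) ∈ S :=
          hS ⟨r, rfl⟩
        refine ⟨_, S.mul_mem h1 hY, Matrix.ext fun i j => ?_⟩
        rw [Submodule.coe_smul, ← h]
        exact scalar_mul_apply r _ i j }
  have hspan : ∀ (P : Submodule R (incidenceModule ι R)) (X : incidenceModule ι R),
      (∀ i j, ∀ hij : i ≤ j, X.1 i j • singleIncidenceModule (R := R) hij ∈ P) → X ∈ P := by
    intro P X hX
    classical
    have hsum : X = ∑ i, ∑ j,
        if hij : i ≤ j then X.1 i j • singleIncidenceModule (R := R) hij else 0 := by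
      refine Subtype.ext ?_
      rw [AddSubmonoidClass.coe_finsetSum]
      conv_lhs => rw [Matrix.matrix_eq_sum_single X.1]
      refine Finset.sum_congr rfl fun i _ => ?_
      rw [AddSubmonoidClass.coe_finsetSum]
      refine Finset.sum_congr rfl fun j _ => ?_
      split_ifs with hij
      · rw [Submodule.coe_smul, singleIncidenceModule, Matrix.smul_single, smul_eq_mul, mul_one]
      · rw [X.2 i j hij, Matrix.single_zero]; rfl
    rw [hsum]
    refine P.sum_mem fun i _ => P.sum_mem fun j _ => ?_
    split_ifs with hij
    · exact hX i j hij
    · exact P.zero_mem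
  have hN : N = ⊤ := by
    refine Submodule.eq_top_of_sup_jacobson_smul_eq_top (top_le_iff.1 fun X _ => ?_)
    refine hspan _ X fun i j hij => Submodule.smul_mem _ _ ?_
    obtain ⟨Y, hY, hYJ⟩ := h i j hij
    let Y' : incidenceModule ι R := ⟨Y.1, Y.2⟩
    rw [← add_sub_cancel Y' (singleIncidenceModule hij)]
    refine Submodule.add_mem_sup ⟨Y, hY, rfl⟩ (hspan _ _ fun p q hpq => ?_)
    exact Submodule.smul_mem_smul (hYJ p q) Submodule.mem_top
  refine (Subring.eq_top_iff' S).2 fun X => ?_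
  obtain ⟨Y, hY, h⟩ : (⟨X.1, X.2⟩ : incidenceModule ι R) ∈ N := hN ▸ Submodule.mem_top
  rwa [show X = Y from Subtype.ext h.symm]

variable {R : Type*} [Ring R] {σ : Type*} [DecidableEq σ] {κ : σ → Type*}
  [∀ s, Fintype (κ s)] [∀ s, DecidableEq (κ s)] {F : σ → Type*} [∀ s, Field (F s)]

/-- The embedding of the scalars of the factor `s` into a product of matrix rings. -/
def coordScalar (κ : σ → Type*) [∀ s, Fintype (κ s)] [∀ s, DecidableEq (κ s)] (F : σ → Type*)
    [∀ s, Field (F s)] (s : σ) : F s →ₙ+* ((s : σ) → Matrix (κ s) (κ s) (F s)) where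
  toFun x := Pi.single s (Matrix.scalar (κ s) x)
  map_mul' x y := by rw [map_mul, Pi.single_mul]
  map_zero' := by rw [map_zero, Pi.single_zero]
  map_add' x y := by rw [map_add, Pi.single_add]

theorem coordScalar_apply (s : σ) (x : F s) :
    coordScalar κ F s x = Pi.single s (Matrix.scalar (κ s) x) := rfl

/-- The matrices over the factor `s` that, as matrices with scalar entries in that factor, lift
to a given subring of the incidence ring. -/
def liftableSubalgebra {π : R →+* ((s : σ) → Matrix (κ s) (κ s) (F s))}
    (hπ : Function.Surjective π) {S : Subring (incidenceRing ι R)}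
    (hS : scalarMatrices ι R ⊆ S) (s : σ) : Subalgebra (F s) (Matrix ι ι (F s)) where
  carrier := {X | X ∈ incidenceRing ι (F s) ∧
    ∃ Y ∈ S, ∀ i j, π ((Y : Matrix ι ι R) i j) = coordScalar κ F s (X i j)}
  mul_mem' := by
    rintro X X' ⟨hX, Y, hY, h⟩ ⟨hX', Y', hY', h'⟩
    refine ⟨mul_mem hX hX', Y * Y', S.mul_mem hY hY', fun i j => ?_⟩
    rw [Subring.coe_mul, Matrix.mul_apply, Matrix.mul_apply, map_sum, map_sum]
    refine Finset.sum_congr rfl fun r _ => ?_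
    rw [map_mul, map_mul, h, h']
  add_mem' := by
    rintro X X' ⟨hX, Y, hY, h⟩ ⟨hX', Y', hY', h'⟩
    refine ⟨add_mem hX hX', Y + Y', S.add_mem hY hY', fun i j => ?_⟩
    rw [Subring.coe_add, Matrix.add_apply, Matrix.add_apply, map_add, map_add, h, h']
  algebraMap_mem' := by
    intro c
    obtain ⟨r, hr⟩ := hπ (coordScalar κ F s c)
    refine ⟨scalar_mem_incidenceRing c,
      ⟨Matrix.scalar ι r, scalar_mem_incidenceRing r⟩, hS ⟨r, rfl⟩, fun i j => ?_⟩
    change π (Matrix.diagonal (fun _ => r) i j) =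
      coordScalar κ F s (Matrix.diagonal (fun _ => c) i j)
    rw [Matrix.diagonal_apply, Matrix.diagonal_apply]
    split_ifs
    · exact hr
    · rw [map_zero, map_zero]

/-- The matrices formed by a fixed coordinate in the factor `s` of the entries of an element of
the subring lift to the subring. -/
theorem map_coord_mem_liftableSubalgebra {π : R →+* ((s : σ) → Matrix (κ s) (κ s) (F s))}
    (hπ : Function.Surjective π) {S : Subring (incidenceRing ι R)}
    (hS : scalarMatrices ι R ⊆ S) {A : incidenceRing ι R} (hA : A ∈ S) (s : σ) (a b : κ s) :
    (A : Matrix ι ι R).map (fun r => π r s a b) ∈ liftableSubalgebra hπ hS s := by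
  refine ⟨fun i j hij => ?_, ?_⟩
  · rw [Matrix.map_apply, A.2 i j hij, map_zero]
    rfl
  · choose ρ hρ using fun p q : κ s => hπ (Pi.single s (Matrix.single p q 1))
    -- In a matrix ring, ∑ c, E_ca M E_bc is the scalar matrix with entry M_ab.
    refine ⟨∑ c, ⟨Matrix.scalar ι (ρ c a), scalar_mem_incidenceRing _⟩ * A *
      ⟨Matrix.scalar ι (ρ b c), scalar_mem_incidenceRing _⟩, ?_, fun i j => ?_⟩
    · exact S.sum_mem fun c _ => S.mul_mem (S.mul_mem (hS ⟨_, rfl⟩) hA) (hS ⟨_, rfl⟩)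
    · rw [AddSubmonoidClass.coe_finsetSum, Matrix.sum_apply, map_sum]
      simp only [Subring.coe_mul, mul_scalar_apply, scalar_mul_apply, map_mul, hρ]
      ext s' p q
      by_cases hs : s' = s
      · subst hs
        simp only [Finset.sum_apply, Pi.mul_apply, Pi.single_eq_same, coordScalar_apply,
          Matrix.map_apply, Matrix.sum_apply,
          Matrix.scalar_apply, Matrix.diagonal_apply]
        simp [Matrix.single_mul_mul_single, Matrix.single_apply, ite_and]
      · simp [coordScalar_apply, hs]

/-- The criterion for a family to generate the incidence ring together with the scalar matrices,
in terms of the simple factors of the coefficient ring. -/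
theorem closure_eq_top_iff [Finite R] [Fintype σ] [∀ s, Nonempty (κ s)]
    {π : R →+* ((s : σ) → Matrix (κ s) (κ s) (F s))}
    (hπ : Function.Surjective π) (hker : ∀ r, π r = 0 → r ∈ Ring.jacobson R)
    {T : Type*} (A : T → incidenceRing ι R) :
    Subring.closure (Set.range A ∪ scalarMatrices ι R) = ⊤ ↔
      ∀ s, (∀ i j : ι, i ≠ j → ∃ t, π ((A t).1 i i) s ≠ π ((A t).1 j j) s) ∧
        ∀ i j : ι, i ⋖ j → ∀ x : F s, ∃ t,
          π ((A t).1 i j) s ≠ x • (π ((A t).1 i i) s - π ((A t).1 j j) s) := by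
  constructor
  · intro htop s
    constructor
    · intro i j hij
      by_contra! hcon
      have key : ∀ X ∈ Subring.closure (Set.range A ∪ scalarMatrices ι R),
          π (X.1 i i) s = π (X.1 j j) s := by
        intro X hX
        induction hX using Subring.closure_induction with
        | mem X hX =>
          rcases hX with ⟨t, rfl⟩ | ⟨r, hr⟩
          · exact hcon t
          · simp [hr]
        | zero => rfl
        | one => simp
        | add X Y _ _ hX hY => simp [hX, hY]
        | neg X _ hX => simp [hX]
        | mul X Y _ _ hX hY =>
          rw [Subring.coe_mul, incidenceRing_mul_apply_self X.2 Y.2,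
            incidenceRing_mul_apply_self X.2 Y.2, map_mul, map_mul, Pi.mul_apply, Pi.mul_apply,
            hX, hY]
      have h1 := key ⟨Matrix.single i i 1, single_mem_incidenceRing le_rfl 1⟩
        (htop ▸ Subring.mem_top _)
      simp [Matrix.single_apply_of_ne, hij] at h1
    · intro i j hij x
      by_contra! hcon
      -- Both sides are derivations for the left action through X i i and the right action through X
      -- j j, because x is central; both vanish on scalar matrices.
      have key : ∀ X ∈ Subring.closure (Set.range A ∪ scalarMatrices ι R),
          π (X.1 i j) s = x • (π (X.1 i i) s - π (X.1 j j) s) := by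
        intro X hX
        induction hX using Subring.closure_induction with
        | mem X hX =>
          rcases hX with ⟨t, rfl⟩ | ⟨r, hr⟩
          · exact hcon t
          · simp [hr, hij.lt.ne]
        | zero => simp
        | one => simp [Matrix.one_apply_ne hij.lt.ne]
        | add X Y _ _ hX hY =>
          simp only [Subring.coe_add, Matrix.add_apply, map_add, Pi.add_apply, hX, hY]
          rw [← smul_add]
          congr 1
          abel
        | neg X _ hX =>
          simp only [Subring.coe_neg, Matrix.neg_apply, map_neg, Pi.neg_apply, hX]
          rw [← smul_neg]
          congr 1
          abel
        | mul X Y _ _ hX hY =>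
          rw [Subring.coe_mul, incidenceRing_mul_apply_self X.2 Y.2,
            incidenceRing_mul_apply_self X.2 Y.2, incidenceRing_mul_apply_covBy X.2 Y.2 hij,
            map_add, map_mul, map_mul, map_mul, map_mul, Pi.add_apply, Pi.mul_apply,
            Pi.mul_apply, Pi.mul_apply, Pi.mul_apply, hX, hY, mul_smul_comm, smul_mul_assoc,
            ← smul_add]
          congr 1
          noncomm_ring
      have h1 := key ⟨Matrix.single i j 1, single_mem_incidenceRing hij.le 1⟩
        (htop ▸ Subring.mem_top _)
      simp [Matrix.single_apply_of_ne, hij.lt.ne, hij.lt.ne'] at h1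
  · intro h
    set S := Subring.closure (Set.range A ∪ scalarMatrices ι R) with hSdef
    have hS : scalarMatrices ι R ⊆ S := Set.subset_union_right.trans Subring.subset_closure
    have hA : ∀ t, A t ∈ S := fun t => Subring.subset_closure (Or.inl ⟨t, rfl⟩)
    have hfull : ∀ s, ∀ X ∈ incidenceRing ι (F s), X ∈ liftableSubalgebra hπ hS s := by
      intro s X hX
      refine mem_of_separates_of_covBy (B := liftableSubalgebra hπ hS s) (fun X hX => hX.1) ?_ ?_ hX
      · intro i j hij
        obtain ⟨t, ht⟩ := (h s).1 i j hij
        by_contra! hcon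
        refine ht (Matrix.ext fun a b => ?_)
        exact hcon _ (map_coord_mem_liftableSubalgebra hπ hS (hA t) s a b)
      · intro i j hij x
        obtain ⟨t, ht⟩ := (h s).2 i j hij x
        by_contra! hcon
        refine ht (Matrix.ext fun a b => ?_)
        exact hcon _ (map_coord_mem_liftableSubalgebra hπ hS (hA t) s a b)
    refine eq_top_of_exists_sub_mem_jacobson hS fun i j hij => ?_
    choose Y hY hYπ using fun s =>
      (hfull s (Matrix.single i j 1) (single_mem_incidenceRing hij 1)).2
    -- Each summand lifts the matrix unit times the identity of one factor; these identities add up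
    -- to 1.
    refine ⟨∑ s, Y s, S.sum_mem fun s _ => hY s, fun p q => hker _ ?_⟩
    rw [map_sub, AddSubmonoidClass.coe_finsetSum, Matrix.sum_apply, map_sum, sub_eq_zero]
    simp only [hYπ, Matrix.single_apply]
    split_ifs
    · rw [map_one]
      simp only [coordScalar_apply, map_one]
      exact (Finset.univ_sum_single (1 : (s : σ) → Matrix (κ s) (κ s) (F s))).symm
    · simp

end Criterion

/-! ### Densities and the count of separated labelings -/

section Counting

/-- The preimage of a set under a surjective homomorphism of finite groups has the same density
as the set. -/
theorem AddMonoidHom.card_preimage_div_card {G H : Type*} [AddGroup G] [AddGroup H] [Finite G]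
    (f : G →+ H) (hf : Function.Surjective f) (S : Set H) :
    (Nat.card (f ⁻¹' S) : ℝ) / Nat.card G = Nat.card S / Nat.card H := by
  have key : ∀ S : Set H, Nat.card (f ⁻¹' S) = Nat.card S * Nat.card f.ker := by
    intro S
    rw [← Nat.card_prod]
    choose g hg using hf
    refine Nat.card_congr
      { toFun := fun x => (⟨f x, x.2⟩, ⟨x - g (f x), ?_⟩)
        invFun := fun y => ⟨y.2 + g y.1, ?_⟩
        left_inv := ?_
        right_inv := ?_ }
    · rw [AddMonoidHom.mem_ker, map_sub, hg, sub_self]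
    · have h : f y.2 = 0 := y.2.2
      rw [Set.mem_preimage, map_add, hg, h, zero_add]
      exact y.1.2
    · intro x
      simp
    · rintro ⟨y, z, hz⟩
      have h : f z = 0 := hz
      simp [hg, h]
  have hG := key Set.univ
  rw [Set.preimage_univ, Nat.card_univ, Nat.card_univ] at hG
  have hne : (Nat.card f.ker : ℝ) ≠ 0 := Nat.cast_ne_zero.2 Nat.card_pos.ne'
  rw [key S, hG, Nat.cast_mul, Nat.cast_mul, mul_div_mul_right _ _ hne]

theorem Nat.cast_descFactorial_eq_prod (Q n : ℕ) :
    (Q.descFactorial n : ℝ) = ∏ i ∈ Finset.range n, ((Q : ℝ) - i) := by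
  induction n with
  | zero => simp
  | succ n ih =>
    rw [Nat.descFactorial_succ, Finset.prod_range_succ, Nat.cast_mul, ← ih, mul_comm]
    -- For n > Q the truncated difference Q - n is harmless, since the earlier factors already
    -- multiply to 0.
    rcases le_or_gt n Q with h | h
    · rw [Nat.cast_sub h]
    · rw [Nat.descFactorial_of_lt h, Nat.cast_zero, zero_mul, zero_mul]

theorem Nat.cast_descFactorial_div_pow {Q n : ℕ} (hQ : Q ≠ 0) :
    (Q.descFactorial n : ℝ) / (Q : ℝ) ^ n = ∏ l ∈ Finset.Icc 1 (n - 1), (1 - (l : ℝ) / Q) := by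
  have hQ' : (Q : ℝ) ≠ 0 := Nat.cast_ne_zero.2 hQ
  have h : (Q : ℝ) ^ n = ∏ _i ∈ Finset.range n, (Q : ℝ) := by simp
  rw [Nat.cast_descFactorial_eq_prod, h, ← Finset.prod_div_distrib]
  -- Only the factor at 0 is dropped, and it equals 1.
  have hsub : Finset.Icc 1 (n - 1) ⊆ Finset.range n := by
    intro l hl
    rw [Finset.mem_Icc] at hl
    rw [Finset.mem_range]
    omega
  rw [← Finset.prod_subset hsub]
  · refine Finset.prod_congr rfl fun l _ => ?_
    rw [sub_div, div_self hQ']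
  · intro l hl hl'
    rw [Finset.mem_range] at hl
    rw [Finset.mem_Icc] at hl'
    obtain rfl : l = 0 := by omega
    rw [Nat.cast_zero, sub_zero, div_self hQ']

/-- The assignments of vectors to the elements and to the strictly comparable pairs of `ι` that
are injective on the elements, and whose value at each covering pair is not a multiple of the
difference of the two values at the elements. -/
def separatedLabelings (ι F V : Type*) [PartialOrder ι] [Field F] [AddCommGroup V] [Module F V] :
    Set ((ι → V) × ({p : ι × ι // p.1 < p.2} → V)) :=
  {f | Function.Injective f.1 ∧
    ∀ p, p.1.1 ⋖ p.1.2 → ∀ x : F, f.2 p ≠ x • (f.1 p.1.1 - f.1 p.1.2)}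

variable {ι F V : Type*} [PartialOrder ι] [Field F] [AddCommGroup V] [Module F V]

/-- A separated labeling consists of an injection and a choice of vectors at the strictly
comparable pairs. -/
def separatedLabelingsEquiv : separatedLabelings ι F V ≃
    (Σ a : ι ↪ V, ∀ p : {p : ι × ι // p.1 < p.2},
      {v : V // p.1.1 ⋖ p.1.2 → ∀ x : F, v ≠ x • (a p.1.1 - a p.1.2)}) where
  toFun f := ⟨⟨f.1.1, f.2.1⟩, fun p => ⟨f.1.2 p, f.2.2 p⟩⟩
  invFun g := ⟨(g.1, fun p => (g.2 p).1), g.1.injective, fun p => (g.2 p).2⟩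
  left_inv _ := rfl
  right_inv _ := rfl

-- A nonzero v spans a line with exactly |F| points. The proposition P will be the covering
-- condition, so that covers and unconstrained pairs fit into one product.
open Classical in
theorem card_ne_smul [Finite V] [Finite F] {v : V} (hv : v ≠ 0) (P : Prop) :
    (Nat.card {w : V // P → ∀ x : F, w ≠ x • v} : ℝ) =
      Nat.card V * if P then 1 - (Nat.card F : ℝ) / Nat.card V else 1 := by
  have hV : (Nat.card V : ℝ) ≠ 0 := Nat.cast_ne_zero.2 Nat.card_pos.ne'
  split_ifs with hP
  · have h1 : Nat.card {w : V // P → ∀ x : F, w ≠ x • v} =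
        ((Set.range fun x : F => x • v)ᶜ).ncard := by
      rw [← Nat.card_coe_set_eq]
      refine Nat.card_congr (Equiv.subtypeEquivRight fun w => ?_)
      simp [hP, eq_comm]
    have h2 : (Set.range fun x : F => x • v).ncard = Nat.card F := by
      rw [← Set.image_univ, Set.ncard_image_of_injective _ (smul_left_injective F hv),
        Set.ncard_univ]
    have h3 := Set.ncard_add_ncard_compl (Set.range fun x : F => x • v)
    rw [h2] at h3
    rw [h1, mul_sub, mul_one, mul_div_cancel₀ _ hV, ← h3, Nat.cast_add]
    ring
  · rw [mul_one, Nat.card_congr (Equiv.subtypeUnivEquiv fun w h => absurd h hP)]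

/-- The density of the separated labelings. -/
theorem card_separatedLabelings_div [Fintype ι] [Finite V] [Finite F] :
    (Nat.card (separatedLabelings ι F V) : ℝ) /
        Nat.card ((ι → V) × ({p : ι × ι // p.1 < p.2} → V)) =
      (1 - (Nat.card F : ℝ) / Nat.card V) ^ numCovers ι *
        ∏ l ∈ Finset.Icc 1 (Fintype.card ι - 1), (1 - (l : ℝ) / Nat.card V) := by
  classical
  have := Fintype.ofFinite V
  have hV : (Nat.card V : ℝ) ≠ 0 := Nat.cast_ne_zero.2 Nat.card_pos.ne'
  have hcov : (Finset.univ.filter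
      fun p : {p : ι × ι // p.1 < p.2} => p.1.1 ⋖ p.1.2).card = numCovers ι := by
    rw [numCovers, ← Nat.subtype_card _ (p := fun p : {p : ι × ι // p.1 < p.2} =>
      p.1.1 ⋖ p.1.2) (by simp)]
    exact Nat.card_congr (Equiv.subtypeSubtypeEquivSubtype fun h => CovBy.lt h)
  rw [Nat.card_congr separatedLabelingsEquiv, Nat.card_sigma, Nat.cast_sum]
  -- The number of choices on pairs does not depend on the injection: injectivity makes every
  -- difference nonzero.
  have hterm : ∀ a : ι ↪ V, ((Nat.card (∀ p : {p : ι × ι // p.1 < p.2},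
      {v : V // p.1.1 ⋖ p.1.2 → ∀ x : F, v ≠ x • (a p.1.1 - a p.1.2)}) : ℕ) : ℝ) =
      (Nat.card V : ℝ) ^ Fintype.card {p : ι × ι // p.1 < p.2} *
        (1 - (Nat.card F : ℝ) / Nat.card V) ^ numCovers ι := by
    intro a
    rw [Nat.card_pi, Nat.cast_prod]
    have : ∀ p : {p : ι × ι // p.1 < p.2},
        (Nat.card {v : V // p.1.1 ⋖ p.1.2 → ∀ x : F, v ≠ x • (a p.1.1 - a p.1.2)} : ℝ) = _ :=
      fun p => card_ne_smul (sub_ne_zero.2 fun h => p.2.ne (a.injective h)) _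
    rw [Finset.prod_congr rfl fun p _ => this p, Finset.prod_mul_distrib, Finset.prod_const,
      Finset.card_univ, Finset.prod_ite, Finset.prod_const, Finset.prod_const_one, mul_one, hcov]
  rw [Finset.sum_congr rfl fun a _ => hterm a, Finset.sum_const, Finset.card_univ,
    Fintype.card_embedding_eq, nsmul_eq_mul, Nat.card_prod, Nat.card_fun, Nat.card_fun,
    ← Nat.cast_descFactorial_div_pow (Nat.card_pos (α := V)).ne']
  simp only [Nat.card_eq_fintype_card] at hV ⊢
  push_cast
  field_simp

end Counting

/-! ### From generating tuples to separated labelings -/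

section Labelings

variable {ι : Type*} [Fintype ι] [DecidableEq ι] [PartialOrder ι]
  {R : Type*} [Ring R] {σ : Type*} {κ : σ → Type*}
  [∀ s, Fintype (κ s)] [∀ s, DecidableEq (κ s)] {F : σ → Type*} [∀ s, Field (F s)]

/-- The entries of a family of elements of the incidence ring, in the matrix coordinates of the
simple factors of the coefficient ring. -/
def labelings (T : Type*) (π : R →+* ((s : σ) → Matrix (κ s) (κ s) (F s))) :
    (T → incidenceRing ι R) →+ ((s : σ) → (ι → T × κ s × κ s → F s) ×
      ({p : ι × ι // p.1 < p.2} → T × κ s × κ s → F s)) where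
  toFun A s := (fun i t => π ((A t.1).1 i i) s t.2.1 t.2.2,
    fun p t => π ((A t.1).1 p.1.1 p.1.2) s t.2.1 t.2.2)
  map_zero' := by
    ext <;> simp
  map_add' A B := by
    ext <;> simp

theorem labelings_surjective (T : Type*)
    {π : R →+* ((s : σ) → Matrix (κ s) (κ s) (F s))} (hπ : Function.Surjective π) :
    Function.Surjective (labelings (ι := ι) T π) := by
  intro f
  choose ρ hρ using hπ
  classical
  refine ⟨fun t => ⟨Matrix.of fun i j =>
    if h : i < j then ρ fun s => Matrix.of fun a b => (f s).2 ⟨(i, j), h⟩ (t, a, b)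
    else if i = j then ρ fun s => Matrix.of fun a b => (f s).1 i (t, a, b) else 0, ?_⟩, ?_⟩
  · intro i j hij
    rw [Matrix.of_apply, dif_neg fun h => hij h.le, if_neg fun h => hij h.le]
  · funext s
    refine Prod.ext ?_ ?_
    · funext i t
      simp [labelings, hρ]
    · funext p t
      have hp : p.1.1 < p.1.2 := p.2
      simp [labelings, hρ, hp]

theorem gen_eq_preimage [Finite R] [Fintype σ] [DecidableEq σ] [∀ s, Nonempty (κ s)]
    {π : R →+* ((s : σ) → Matrix (κ s) (κ s) (F s))}
    (hπ : Function.Surjective π) (hker : ∀ r, π r = 0 → r ∈ Ring.jacobson R) (m : ℕ) :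
    Gen ι R m = labelings (Fin m) π ⁻¹' Set.univ.pi fun s =>
      separatedLabelings ι (F s) (Fin m × κ s × κ s → F s) := by
  -- A tuple of m matrices is read as a single vector, so that "some t differs" becomes an
  -- inequality of vectors.
  have hext : ∀ {s : σ} {X Y : Fin m → Matrix (κ s) (κ s) (F s)},
      (fun t : Fin m × κ s × κ s => X t.1 t.2.1 t.2.2) =
        (fun t => Y t.1 t.2.1 t.2.2) ↔ ∀ t, X t = Y t := by
    intro s X Y
    refine ⟨fun h t => Matrix.ext fun a b => congrFun h (t, a, b), fun h => ?_⟩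
    funext t
    rw [h t.1]
  ext A
  rw [Gen, Set.mem_ofPred_eq, closure_eq_top_iff hπ hker, Set.mem_preimage, Set.mem_univ_pi]
  refine forall_congr' fun s => and_congr ?_ ?_
  · refine forall_congr' fun i => forall_congr' fun j => ?_
    rw [← not_imp_not, not_not]
    refine imp_congr_left ?_
    push Not
    exact (hext (X := fun t => π ((A t).1 i i) s) (Y := fun t => π ((A t).1 j j) s)).symm
  · constructor
    · rintro h ⟨⟨i, j⟩, hp⟩ hij x heq
      obtain ⟨t, ht⟩ := h i j hij x
      exact ht ((hext (X := fun t => π ((A t).1 i j) s)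
        (Y := fun t => x • (π ((A t).1 i i) s - π ((A t).1 j j) s))).1 heq t)
    · intro h i j hij x
      by_contra! hcon
      exact h ⟨(i, j), hij.lt⟩ hij x ((hext (X := fun t => π ((A t).1 i j) s)
        (Y := fun t => x • (π ((A t).1 i i) s - π ((A t).1 j j) s))).2 hcon)

end Labelings

theorem genProbability_eq_card_div (ι R : Type*) [Fintype ι] [DecidableEq ι] [PartialOrder ι]
    [Ring R] [Finite R] (m : ℕ) :
    genProbability ι R m =
      (Nat.card (Gen ι R m) : ℝ) / Nat.card (Fin m → incidenceRing ι R) := by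
  let _ : Fintype (Fin m → incidenceRing ι R) := Fintype.ofFinite _
  let _ : Fintype (Gen ι R m) := Fintype.ofFinite _
  rw [genProbability, PMF.toOuterMeasure_uniformOfFintype_apply, ENNReal.toReal_div,
    ENNReal.toReal_natCast, ENNReal.toReal_natCast, ← Nat.card_eq_fintype_card,
    ← Nat.card_eq_fintype_card]

/-- The density of the generating tuples is the product over the simple factors of the densities
of the separated labelings. -/
theorem genProbability_eq_prod {ι : Type*} [Fintype ι] [DecidableEq ι] [PartialOrder ι]
    {R : Type*} [Ring R] [Finite R] {σ : Type*} [Fintype σ] [DecidableEq σ] {κ : σ → Type*}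
    [∀ s, Fintype (κ s)] [∀ s, DecidableEq (κ s)] [∀ s, Nonempty (κ s)] {F : σ → Type*}
    [∀ s, Field (F s)] {π : R →+* ((s : σ) → Matrix (κ s) (κ s) (F s))}
    (hπ : Function.Surjective π) (hker : ∀ r, π r = 0 → r ∈ Ring.jacobson R) (m : ℕ) :
    genProbability ι R m = ∏ s,
      (Nat.card (separatedLabelings ι (F s) (Fin m × κ s × κ s → F s)) : ℝ) /
        Nat.card ((ι → Fin m × κ s × κ s → F s) ×
          ({p : ι × ι // p.1 < p.2} → Fin m × κ s × κ s → F s)) := by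
  rw [genProbability_eq_card_div, gen_eq_preimage hπ hker,
    AddMonoidHom.card_preimage_div_card _ (labelings_surjective (Fin m) hπ),
    Nat.card_congr (Equiv.Set.univPi _), Nat.card_pi, Nat.card_pi, Nat.cast_prod,
    Nat.cast_prod, ← Finset.prod_div_distrib]

theorem mainTheorem2 {ι R : Type*} [Fintype ι] [DecidableEq ι] [PartialOrder ι]
    [Ring R] [Nontrivial R] [Finite R]
    (n : ℕ) (hn : 1 ≤ n) (hcard : Fintype.card ι = n)
    (d : ℕ) (k : Fin d → ℕ) (hk : ∀ i, 1 ≤ k i)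
    (F : Fin d → Type*) [∀ i, Field (F i)] [∀ i, Finite (F i)]
    (q : Fin d → ℕ) (hq : ∀ i, Nat.card (F i) = q i)
    (e : (R ⧸ Ring.jacobson R) ≃+* ((i : Fin d) → Matrix (Fin (k i)) (Fin (k i)) (F i)))
    (m : ℕ) (hm : mgen ι R ≤ m) :
    genProbability ι R m =
      ∏ i : Fin d,
        ((1 - 1 / (q i : ℝ) ^ ((k i : ℤ) ^ 2 * (m : ℤ) - 1)) ^ numCovers ι *
          ∏ l ∈ Finset.Icc 1 (n - 1), (1 - (l : ℝ) / (q i : ℝ) ^ (k i ^ 2 * m))) := by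
  let π : R →+* ((i : Fin d) → Matrix (Fin (k i)) (Fin (k i)) (F i)) :=
    e.toRingHom.comp (Ideal.Quotient.mk (Ring.jacobson R))
  have hπ : Function.Surjective π := e.surjective.comp Ideal.Quotient.mk_surjective
  have hker : ∀ r, π r = 0 → r ∈ Ring.jacobson R := fun r hr =>
    Ideal.Quotient.eq_zero_iff_mem.1 ((map_eq_zero_iff e e.injective).1 hr)
  have hne : ∀ i, Nonempty (Fin (k i)) := fun i => ⟨⟨0, hk i⟩⟩
  rw [genProbability_eq_prod hπ hker]
  refine Finset.prod_congr rfl fun i _ => ?_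
  have hV : Nat.card (Fin m × Fin (k i) × Fin (k i) → F i) = q i ^ (k i ^ 2 * m) := by
    rw [Nat.card_fun, hq, Nat.card_prod, Nat.card_prod, Nat.card_fin, Nat.card_fin]
    congr 1
    ring
  have hq0 : (q i : ℝ) ≠ 0 := by
    rw [← hq i]
    exact Nat.cast_ne_zero.2 Nat.card_pos.ne'
  -- Here |F|/|V| = q / q^(k²m) = 1 / q^(k²m - 1); the exponent is an integer because it is -1 when
  -- m = 0.
  rw [card_separatedLabelings_div, hV, hq, hcard, Nat.cast_pow, zpow_sub_one₀ hq0, one_div,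
    mul_inv_rev, inv_inv, ← div_eq_mul_inv]
  norm_cast
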